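/- Let $1\le k<n$ and $\mathcal Y=[n]=\{1,\dots,n\}$. For $u\in\mathbb R^n$ let $u_{[i]}$ denote its $i$-th largest entry (with multiplicity), let $[x]_+=\max(x,0)$, let $\|u\|_0$ be the number of nonzero entries of $u$, and let $e_y$ be the $y$-th unit vector. Define the surrogate $$L_3(u,y)=\frac1k\sum_{i=1}^k\bigl[1-u_y+(u-e_y)_{[i]}\bigr]_+ ,\qquad u\in\mathbb R^n,\ y\in\mathcal Y .$$ For a loss $L:\mathcal R\times\mathcal Y\to\mathbb R_+$ and a probability vector $p\in\Delta_{\mathcal Y}$ let $\mathrm{prop}[L](p)=\arg\min_{r\in\mathcal R}\sum_y p_yL(r,y)$. A set $S\subseteq\mathcal R$ is representative for $L$ if $\mathrm{prop}[L](p)\cap S\neq\emptyset$ for all $p\in\Delta_{\mathcal Y}$. A loss $L$ on $\mathbb R^d$ embeds a discrete loss $\ell:\mathcal R\times\mathcal Y\to\mathbb R_+$ (with $\mathcal R$ finite) if there are a representative set $S$ for $\ell$ and an injection $\varphi:S\to\mathbb R^d$ such that $L(\varphi(r),y)=\ell(r,y)$ for all $r\in S$, $y\in\mathcal Y$, and $r\in\mathrm{prop}[\ell](p)\iff\varphi(r)\in\mathrm{prop}[L](p)$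 for all $p\in\Delta_{\mathcal Y}$, $r\in S$. Let $$\mathcal U_3=\{u\in\mathbb R^n_+ : \|u\|_0\le k,\ u_{[i+1]}\le u_{[i]}\le u_{[i+1]}+1 \text{ for } i=1,\dots,k\},\qquad R_3=\mathcal U_3\cap\{0,1,\dots,k\}^n .$$ Let $\mathcal Q$ be the set of ordered partitions $Q=(Q_0,\dots,Q_s)$ of $[n]$ into nonempty, pairwise disjoint blocks with $s\le k$ and $|Q_1\cup\dots\cup Q_s|\le k$. For $Q\in\mathcal Q$ and $y\in Q_j$ define $$\hat\ell_3(Q,y)=\begin{cases}\dfrac1k\Bigl(|Q_j|-1+\sum_{i>j}|Q_i|(i-j+1)\Bigr)& j>0,\\[2mm] \dfrac1k\Bigl(k-\sum_{i=1}^s|Q_i|+\sum_{i=1}^s|Q_i|(i+1)\Bigr)& j=0.\end{cases}$$ Then: (1) $R_3$ is a finite representative set for $L_3$. (2) The map sending $Q\in\mathcal Q$ to the vector $u$ with $u_y=j$ for $y\in Q_j$ is a bijection from $\mathcal Q$ onto $R_3$ (its inverse is $u\mapsto(\{i:u_i=0\},\{i:u_i=1\},\dots,\{i:u_i=s\})$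 with $s=\max_i u_i$), and $L_3(u,y)=\hat\ell_3(Q,y)$ for all $y\in\mathcal Y$ whenever $u$ is the image of $Q$. (3) $L_3$ and $\hat\ell_3$ are nonnegative, $\mathcal Q$ is finite, and $L_3$ embeds $\hat\ell_3$. -/

import Mathlib

noncomputable section

namespace TopK

open Finset

/-- `sortDesc u i` is the `(i+1)`-st largest entry of `u`, counted with multiplicity: the paper's
`u_{[i+1]}` (positions `i : Fin n` are numbered from `0`). -/
def sortDesc {n : ℕ} (u : Fin n → ℝ) (i : Fin n) : ℝ :=
  u (Tuple.sort (fun j => -u j) i)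

/-! ### Losses, elicited properties, representative sets, embeddings

A loss with reports in `R` and labels `Fin n` is a function `R → Fin n → ℝ`; the distributions on
the labels are the elements of `stdSimplex ℝ (Fin n)`. -/

/-- The expected loss of the report `r` when the label is drawn from `p`. -/
def expLoss {n : ℕ} {R : Type*} (L : R → Fin n → ℝ) (p : Fin n → ℝ) (r : R) : ℝ :=
  ∑ y, p y * L r y

/-- The property elicited by `L`: the set of minimizers of the expected loss. -/
def prop {n : ℕ} {R : Type*} (L : R → Fin n → ℝ) (p : Fin n → ℝ) : Set R :=
  {r | ∀ r', expLoss L p r ≤ expLoss L p r'}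

/-- `S` contains, for every label distribution, a minimizer of the expected loss. -/
def IsRepresentative {n : ℕ} {R : Type*} (L : R → Fin n → ℝ) (S : Set R) : Prop :=
  ∀ p ∈ stdSimplex ℝ (Fin n), (prop L p ∩ S).Nonempty

/-- The surrogate loss `L` on `ℝ^d` embeds the loss `l`. -/
def Embeds {n d : ℕ} {R : Type*} (L : (Fin d → ℝ) → Fin n → ℝ) (l : R → Fin n → ℝ) : Prop :=
  ∃ S : Set R, IsRepresentative l S ∧
    ∃ φ : S → (Fin d → ℝ), Function.Injective φ ∧
      (∀ (r : S) (y : Fin n), L (φ r) y = l r y) ∧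
      ∀ p ∈ stdSimplex ℝ (Fin n), ∀ r : S, (r : R) ∈ prop l p ↔ φ r ∈ prop L p

/-! ### The surrogate and its representative region -/

/-- `L₃(u, y) = (1/k) ∑_{i=1}^k [1 - u_y + (u - e_y)_{[i]}]_+`. -/
def L3 (n k : ℕ) (u : Fin n → ℝ) (y : Fin n) : ℝ :=
  (1 / (k : ℝ)) * ∑ i : Fin n with i.val < k,
    max 0 (1 - u y + sortDesc (u - Pi.single y 1) i)

/-- Nonnegative vectors with at most `k` nonzero entries. -/
def RLow (n k : ℕ) : Set (Fin n → ℝ) :=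
  {u | (∀ i, 0 ≤ u i) ∧ #{i : Fin n | u i ≠ 0} ≤ k}

/-- Vectors with `u_{[i+1]} ≤ u_{[i]} ≤ u_{[i+1]} + 1` for `i = 1, …, k`. -/
def RHigh (n k : ℕ) : Set (Fin n → ℝ) :=
  {u | ∀ i j : Fin n, i.val < k → j.val = i.val + 1 →
    sortDesc u j ≤ sortDesc u i ∧ sortDesc u i ≤ sortDesc u j + 1}

/-- The bounded region `U₃`. -/
def U3 (n k : ℕ) : Set (Fin n → ℝ) := RHigh n k ∩ RLow n k

/-- The points of `U₃` with all coordinates in `{0, 1, …, k}`. -/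
def R3 (n k : ℕ) : Set (Fin n → ℝ) :=
  U3 n k ∩ {u | ∀ y, ∃ m : ℕ, m ≤ k ∧ u y = m}

/-! ### Ordered partitions and the discrete loss -/

/-- Ordered partitions `(Q_0, …, Q_s)` of the label set into nonempty blocks, with `s ≤ k` and
`|Q_1 ∪ … ∪ Q_s| ≤ k`. -/
structure OrdPartition (n k : ℕ) where
  s : ℕ
  block : Fin (s + 1) → Finset (Fin n)
  s_le : s ≤ k
  disjoint : ∀ i j, i ≠ j → Disjoint (block i) (block j)
  nonempty : ∀ i, (block i).Nonempty
  cover : ∀ y, ∃ i, y ∈ block i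
  card_le : #((Ioi (0 : Fin (s + 1))).biUnion block) ≤ k

namespace OrdPartition

variable {n k : ℕ}

/-- The index `j` of the block `Q_j` that contains `y`. -/
def index (Q : OrdPartition n k) (y : Fin n) : Fin (Q.s + 1) :=
  Classical.choose (Q.cover y)

theorem mem_block_index (Q : OrdPartition n k) (y : Fin n) : y ∈ Q.block (Q.index y) :=
  Classical.choose_spec (Q.cover y)

theorem mem_block_iff (Q : OrdPartition n k) (y : Fin n) (j : Fin (Q.s + 1)) :
    y ∈ Q.block j ↔ Q.index y = j := by
  constructor
  · intro h
    by_contra hne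
    exact Finset.disjoint_left.mp (Q.disjoint _ _ hne) (Q.mem_block_index y) h
  · rintro rfl
    exact Q.mem_block_index y

/-- The vector `u` with `u_y = j` for `y ∈ Q_j`; it is the inverse of
`u ↦ ({i | u_i = 0}, {i | u_i = 1}, …, {i | u_i = s})`. -/
def toVec (Q : OrdPartition n k) (y : Fin n) : ℝ := ((Q.index y).val : ℝ)

end OrdPartition

/-- The discrete loss on ordered partitions, with `j` the index of the block containing `y`. -/
def hatL3 (n k : ℕ) (Q : OrdPartition n k) (y : Fin n) : ℝ :=
  if Q.index y = 0 then
    (1 / (k : ℝ)) * (((k : ℝ) - ∑ i ∈ Ioi (0 : Fin (Q.s + 1)), (#(Q.block i) : ℝ)) +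
      ∑ i ∈ Ioi (0 : Fin (Q.s + 1)), (#(Q.block i) : ℝ) * ((i.val : ℝ) + 1))
  else
    (1 / (k : ℝ)) * ((#(Q.block (Q.index y)) : ℝ) - 1 +
      ∑ i ∈ Ioi (Q.index y),
        (#(Q.block i) : ℝ) * ((i.val : ℝ) - ((Q.index y).val : ℝ) + 1))

end TopK

end

namespace TopK

open Finset

/-! ### Top sets -/

/-- Any finite set with at least `m` elements has an `m`-element subset on which `h` dominates the
rest. -/
theorem exists_top_subset {ι α : Type*} [DecidableEq ι] [LinearOrder α] (h : ι → α)
    (A : Finset ι) (m : ℕ) (hm : m ≤ #A) :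
    ∃ T ⊆ A, #T = m ∧ ∀ j ∈ T, ∀ l ∈ A, l ∉ T → h l ≤ h j := by
  induction m with
  | zero => exact ⟨∅, by simp, by simp, by simp⟩
  | succ m ih =>
    obtain ⟨T, hTA, hT, htop⟩ := ih (by omega)
    have hne : (A \ T).Nonempty := by
      rw [← card_pos, card_sdiff_of_subset hTA]
      omega
    obtain ⟨a, ha, hmax⟩ := exists_max_image (A \ T) h hne
    rw [mem_sdiff] at ha
    refine ⟨insert a T, insert_subset ha.1 hTA, by rw [card_insert_of_notMem ha.2, hT], ?_⟩
    intro j hj l hl hlT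
    rw [mem_insert, not_or] at hlT
    rcases mem_insert.1 hj with rfl | hj
    · exact hmax l (mem_sdiff.2 ⟨hl, hlT.2⟩)
    · exact htop j hj l hl hlT.2

/-- A set of largest values has the largest sum among all sets of at most its size. -/
theorem sum_le_sum_of_top {ι : Type*} [DecidableEq ι] (h : ι → ℝ) (S T : Finset ι)
    (h0 : ∀ j, 0 ≤ h j) (hcard : #S ≤ #T) (htop : ∀ j ∈ T, ∀ l, l ∉ T → h l ≤ h j) :
    ∑ j ∈ S, h j ≤ ∑ j ∈ T, h j := by
  have hST := sum_inter_add_sum_sdiff S T h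
  have hTS := sum_inter_add_sum_sdiff T S h
  rw [inter_comm] at hTS
  have hc : #(S \ T) ≤ #(T \ S) := by
    have h1 := card_sdiff_add_card_inter S T
    have h2 := card_sdiff_add_card_inter T S
    rw [inter_comm] at h2
    omega
  suffices ∑ j ∈ S \ T, h j ≤ ∑ j ∈ T \ S, h j by linarith
  rcases (T \ S).eq_empty_or_nonempty with he | hne
  · rw [he, card_empty, Nat.le_zero, card_eq_zero] at hc
    rw [he, hc]
  · obtain ⟨a, ha, hmin⟩ := exists_min_image (T \ S) h hne
    calc ∑ j ∈ S \ T, h j ≤ #(S \ T) • h a :=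
          sum_le_card_nsmul _ _ _ fun j hj =>
            htop a (mem_sdiff.1 ha).1 j (mem_sdiff.1 hj).2
      _ ≤ #(T \ S) • h a := nsmul_le_nsmul_left (h0 a) hc
      _ ≤ ∑ j ∈ T \ S, h j := card_nsmul_le_sum _ _ _ hmin

variable {n k : ℕ}

theorem sortDesc_antitone (u : Fin n → ℝ) : Antitone (sortDesc u) := by
  intro i j hij
  have := Tuple.monotone_sort (fun j => -u j) hij
  simpa [sortDesc] using this

theorem exists_sortDesc_eq (u : Fin n → ℝ) (y : Fin n) : ∃ i, sortDesc u i = u y :=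
  ⟨(Tuple.sort (fun j => -u j)).symm y, by simp [sortDesc]⟩

theorem card_val_lt (hkn : k ≤ n) : #{i : Fin n | i.val < k} = k := by
  simp [Fin.card_filter_val_lt, hkn]

/-! ### The surrogate as a sum over the largest competitors -/

theorem L3_eq_sum (hkn : k < n) (u : Fin n → ℝ) (y : Fin n) (T : Finset (Fin n)) (hy : y ∉ T)
    (hT : #T = k) (htop : ∀ j ∈ T, ∀ l, l ≠ y → l ∉ T → u l ≤ u j) :
    L3 n k u y = (1 / (k : ℝ)) * ∑ j ∈ T, max 0 (1 + u j - u y) := by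
  set v : Fin n → ℝ := u - Pi.single y 1 with hv
  set g : Fin n → ℝ := fun j => max 0 (1 - u y + v j) with hg
  have hgy : g y = 0 := by simp [hg, hv]
  have hgj : ∀ j, j ≠ y → g j = max 0 (1 + u j - u y) := by
    intro j hj
    simp only [hg, hv, Pi.sub_apply, Pi.single_eq_of_ne hj, sub_zero]
    congr 1
    ring
  have hg0 : ∀ j, 0 ≤ g j := fun j => le_max_left _ _
  set σ := Tuple.sort (fun j => -v j)
  set S : Finset (Fin n) := ({i : Fin n | i.val < k} : Finset (Fin n)).map σ.toEmbedding with hS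
  have hScard : #S = k := by rw [hS, card_map, card_val_lt hkn.le]
  have hL : L3 n k u y = (1 / (k : ℝ)) * ∑ j ∈ S, g j := by
    rw [hS, sum_map]
    rfl
  have hStop : ∀ j ∈ S, ∀ l, l ∉ S → g l ≤ g j := by
    intro j hj l hl
    obtain ⟨i, hi, rfl⟩ := mem_map.1 hj
    obtain ⟨i', rfl⟩ := σ.surjective l
    have hi' : ¬ i'.val < k := fun h => hl (mem_map.2 ⟨i', by simpa using h, rfl⟩)
    have hi : i.val < k := by simpa using hi
    have := sortDesc_antitone v (show i ≤ i' from Fin.le_def.2 (by omega))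
    exact max_le_max le_rfl (add_le_add le_rfl this)
  have hTtop : ∀ j ∈ T, ∀ l, l ∉ T → g l ≤ g j := by
    intro j hj l hl
    rcases eq_or_ne l y with rfl | hly
    · rw [hgy]; exact hg0 j
    · rw [hgj l hly, hgj j (fun h => hy (h ▸ hj))]
      exact max_le_max le_rfl (by linarith [htop j hj l hly hl])
  rw [hL, le_antisymm (sum_le_sum_of_top g S T hg0 (by omega) hTtop)
    (sum_le_sum_of_top g T S hg0 (by omega) hStop)]
  congr 1
  exact sum_congr rfl fun j hj => hgj j fun h => hy (h ▸ hj)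

theorem exists_competitors (hkn : k < n) {α : Type*} [LinearOrder α] (u : Fin n → α) (y : Fin n) :
    ∃ T : Finset (Fin n), y ∉ T ∧ #T = k ∧ ∀ j ∈ T, ∀ l, l ≠ y → l ∉ T → u l ≤ u j := by
  obtain ⟨T, hTA, hT, htop⟩ := exists_top_subset u (univ.erase y) k (by simp; omega)
  exact ⟨T, fun h => by simpa using hTA h, hT, fun j hj l hl hlT => htop j hj l (by simp [hl]) hlT⟩

theorem L3_nonneg (u : Fin n → ℝ) (y : Fin n) : 0 ≤ L3 n k u y :=
  mul_nonneg (by positivity) (sum_nonneg fun _ _ => le_max_left _ _)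

/-! ### Rounding to integer vectors -/

theorem intervalIntegrable_floor_add (a : ℝ) :
    IntervalIntegrable (fun t : ℝ => (⌊a + t⌋ : ℝ)) MeasureTheory.volume 0 1 := by
  apply Monotone.intervalIntegrable
  intro s t hst
  exact Int.cast_le.2 (Int.floor_mono (by simpa using hst))

theorem integral_floor_add (a : ℝ) : ∫ t in (0 : ℝ)..1, (⌊a + t⌋ : ℝ) = a := by
  have hfl := intervalIntegrable_floor_add a
  have hlin : IntervalIntegrable (fun t : ℝ => a + t) MeasureTheory.volume 0 1 :=
    (by fun_prop : Continuous fun t : ℝ => a + t).intervalIntegrable _ _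
  have h1 : ∫ t in (0 : ℝ)..1, ((a + t) - (⌊a + t⌋ : ℝ)) = 1 / 2 := by
    have hper : Function.Periodic (Int.fract : ℝ → ℝ) 1 := Int.fract_periodic ℝ
    calc ∫ t in (0 : ℝ)..1, ((a + t) - (⌊a + t⌋ : ℝ))
        = ∫ t in (0 : ℝ)..1, Int.fract (a + t) := rfl
      _ = ∫ t in a..(a + 1), Int.fract t := by
          rw [intervalIntegral.integral_comp_add_left (fun t => Int.fract t)]; simp
      _ = ∫ t in (0 : ℝ)..(0 + 1), Int.fract t := hper.intervalIntegral_add_eq a 0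
      _ = ∫ t in (0 : ℝ)..1, t := by
          rw [zero_add]
          refine intervalIntegral.integral_congr_ae ?_
          filter_upwards [MeasureTheory.Measure.ae_ne MeasureTheory.volume (1 : ℝ)] with t ht1 ht
          rw [Set.uIoc_of_le zero_le_one] at ht
          exact Int.fract_eq_self.2 ⟨ht.1.le, lt_of_le_of_ne ht.2 ht1⟩
      _ = 1 / 2 := by simp
  rw [intervalIntegral.integral_sub hlin hfl] at h1
  have h2 : ∫ t in (0 : ℝ)..1, (a + t) = a + 1 / 2 := by
    rw [intervalIntegral.integral_add (by simp) (by simp)]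
    simp
  linarith

/-- The hinge of a difference is the average of its values at the simultaneous roundings. -/
theorem hinge_floor_average (a b : ℝ) :
    IntervalIntegrable (fun t : ℝ => max 0 (1 + (⌊a + t⌋ : ℝ) - (⌊b + t⌋ : ℝ)))
      MeasureTheory.volume 0 1 ∧
    ∫ t in (0 : ℝ)..1, max 0 (1 + (⌊a + t⌋ : ℝ) - (⌊b + t⌋ : ℝ)) = max 0 (1 + a - b) := by
  have ha := intervalIntegrable_floor_add a
  have hb := intervalIntegrable_floor_add b
  have h1 : IntervalIntegrable (fun _ : ℝ => (1 : ℝ)) MeasureTheory.volume 0 1 := by simp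
  rcases le_or_gt b (a + 1) with h | h
  · have he : ∀ t : ℝ, max 0 (1 + (⌊a + t⌋ : ℝ) - (⌊b + t⌋ : ℝ))
        = 1 + (⌊a + t⌋ : ℝ) - (⌊b + t⌋ : ℝ) := by
      intro t
      apply max_eq_right
      have : ⌊b + t⌋ ≤ ⌊a + t⌋ + 1 := by
        rw [← Int.floor_add_one]
        exact Int.floor_mono (by linarith)
      have : (⌊b + t⌋ : ℝ) ≤ (⌊a + t⌋ : ℝ) + 1 := by exact_mod_cast this
      linarith
    simp only [he]
    refine ⟨(h1.add ha).sub hb, ?_⟩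
    rw [intervalIntegral.integral_sub (h1.add ha) hb, intervalIntegral.integral_add h1 ha,
      integral_floor_add, integral_floor_add, max_eq_right (by linarith)]
    simp
  · have he : ∀ t : ℝ, max 0 (1 + (⌊a + t⌋ : ℝ) - (⌊b + t⌋ : ℝ)) = 0 := by
      intro t
      apply max_eq_left
      have : ⌊a + t⌋ + 1 ≤ ⌊b + t⌋ := by
        rw [← Int.floor_add_one]
        exact Int.floor_mono (by linarith)
      have : (⌊a + t⌋ : ℝ) + 1 ≤ (⌊b + t⌋ : ℝ) := by exact_mod_cast this
      linarith
    simp only [he]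
    exact ⟨by simp, by rw [max_eq_left (by linarith)]; simp⟩

theorem exists_int_expLoss_le (hkn : k < n) (p u : Fin n → ℝ) :
    ∃ z : Fin n → ℤ, expLoss (L3 n k) p (fun y => (z y : ℝ)) ≤ expLoss (L3 n k) p u := by
  choose T hyT hT htop using exists_competitors hkn u
  set F : ℝ → ℝ := fun t => expLoss (L3 n k) p (fun y => (⌊u y + t⌋ : ℝ)) with hF
  have hFeq : F = fun t => ∑ y, p y * ((1 / (k : ℝ)) *
      ∑ j ∈ T y, max 0 (1 + (⌊u j + t⌋ : ℝ) - (⌊u y + t⌋ : ℝ))) := by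
    funext t
    refine sum_congr rfl fun y _ => ?_
    rw [L3_eq_sum hkn _ y (T y) (hyT y) (hT y)]
    intro j hj l hl hlT
    have := htop y j hj l hl hlT
    exact Int.cast_le.2 (Int.floor_mono (by linarith))
  have hin : ∀ y, IntervalIntegrable (fun t : ℝ => ∑ j ∈ T y,
      max 0 (1 + (⌊u j + t⌋ : ℝ) - (⌊u y + t⌋ : ℝ))) MeasureTheory.volume 0 1 := by
    intro y
    have := IntervalIntegrable.sum (T y) (f := fun j (t : ℝ) =>
      max 0 (1 + (⌊u j + t⌋ : ℝ) - (⌊u y + t⌋ : ℝ))) (μ := MeasureTheory.volume) (a := 0) (b := 1)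
      fun j _ => (hinge_floor_average (u j) (u y)).1
    simpa [Finset.sum_fn] using this
  have hin2 : ∀ y, IntervalIntegrable (fun t : ℝ => p y * ((1 / (k : ℝ)) * ∑ j ∈ T y,
      max 0 (1 + (⌊u j + t⌋ : ℝ) - (⌊u y + t⌋ : ℝ)))) MeasureTheory.volume 0 1 :=
    fun y => ((hin y).const_mul _).const_mul _
  have hFint : IntervalIntegrable F MeasureTheory.volume 0 1 := by
    rw [hFeq]
    have := IntervalIntegrable.sum univ (f := fun y (t : ℝ) => p y * ((1 / (k : ℝ)) * ∑ j ∈ T y,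
      max 0 (1 + (⌊u j + t⌋ : ℝ) - (⌊u y + t⌋ : ℝ)))) (μ := MeasureTheory.volume) (a := 0) (b := 1)
      fun y _ => hin2 y
    simpa [Finset.sum_fn] using this
  have hFavg : ∫ t in (0 : ℝ)..1, F t = expLoss (L3 n k) p u := by
    rw [hFeq, intervalIntegral.integral_finsetSum fun y _ => hin2 y]
    refine sum_congr rfl fun y _ => ?_
    rw [intervalIntegral.integral_const_mul, intervalIntegral.integral_const_mul,
      intervalIntegral.integral_finsetSum fun j _ => (hinge_floor_average (u j) (u y)).1,
      L3_eq_sum hkn u y (T y) (hyT y) (hT y) (htop y)]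
    simp only [(hinge_floor_average _ _).2]
  by_contra! hcon
  have hpos := intervalIntegral.intervalIntegral_pos_of_pos
    (hFint.sub (intervalIntegrable_const (c := expLoss (L3 n k) p u)))
    (fun t => sub_pos.2 (hcon fun y => ⌊u y + t⌋)) zero_lt_one
  rw [intervalIntegral.integral_sub hFint intervalIntegrable_const, hFavg,
    intervalIntegral.integral_const, sub_zero, one_smul, sub_self] at hpos
  exact lt_irrefl _ hpos

/-! ### Ordered partitions as vectors -/

namespace OrdPartition

theorem exists_index_eq (Q : OrdPartition n k) (i : Fin (Q.s + 1)) : ∃ y, Q.index y = i := by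
  obtain ⟨y, hy⟩ := Q.nonempty i
  exact ⟨y, (Q.mem_block_iff y i).1 hy⟩

theorem block_eq_filter (Q : OrdPartition n k) (i : Fin (Q.s + 1)) :
    Q.block i = ({y : Fin n | Q.index y = i} : Finset (Fin n)) := by
  ext y
  simp [Q.mem_block_iff]

theorem card_index_ne_zero (Q : OrdPartition n k) : #{y : Fin n | Q.index y ≠ 0} ≤ k := by
  refine (card_le_card fun y hy => ?_).trans Q.card_le
  simp only [mem_filter, mem_univ, true_and] at hy
  exact mem_biUnion.2 ⟨Q.index y, mem_Ioi.2 (Fin.pos_of_ne_zero hy), Q.mem_block_index y⟩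

theorem toVec_eq_zero_iff (Q : OrdPartition n k) (y : Fin n) :
    Q.toVec y = 0 ↔ Q.index y = 0 := by
  rw [Fin.ext_iff]
  exact Nat.cast_eq_zero

theorem toVec_nonneg (Q : OrdPartition n k) (y : Fin n) : 0 ≤ Q.toVec y :=
  Nat.cast_nonneg _

theorem toVec_injective : Function.Injective (toVec : OrdPartition n k → Fin n → ℝ) := by
  have key : ∀ Q Q' : OrdPartition n k, Q.toVec = Q'.toVec → Q.s ≤ Q'.s := by
    intro Q Q' h
    obtain ⟨y, hy⟩ := Q.exists_index_eq (Fin.last _)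
    have h1 : (Q.index y).val = (Q'.index y).val := by
      have := congrFun h y
      simpa [toVec] using this
    have h2 := (Q'.index y).isLt
    rw [hy, Fin.val_last] at h1
    omega
  intro Q Q' h
  have hs := le_antisymm (key Q Q' h) (key Q' Q h.symm)
  have hi : ∀ y, (Q.index y).val = (Q'.index y).val := fun y => by
    have := congrFun h y
    simpa [toVec] using this
  have hb : ∀ (i : Fin (Q.s + 1)) (i' : Fin (Q'.s + 1)), i.val = i'.val →
      Q.block i = Q'.block i' := by
    intro i i' hii
    ext y
    rw [Q.mem_block_iff, Q'.mem_block_iff, Fin.ext_iff, Fin.ext_iff, hi, hii]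
  obtain ⟨s, block, _, _, _, _, _⟩ := Q
  obtain ⟨s', block', _, _, _, _, _⟩ := Q'
  obtain rfl : s = s' := hs
  obtain rfl : block = block' := funext fun i => hb i i rfl
  rfl

/-- A vector of naturals whose values form an initial segment and which has at most `k` nonzero
entries comes from an ordered partition. -/
theorem exists_toVec_eq (hkn : k < n) (f : Fin n → ℕ) (hf : #{y : Fin n | f y ≠ 0} ≤ k)
    (hseg : ∀ y, ∀ m ≤ f y, ∃ y', f y' = m) :
    ∃ Q : OrdPartition n k, Q.toVec = fun y => (f y : ℝ) := by
  obtain ⟨y₀, -, hmax⟩ := exists_max_image univ f ⟨⟨0, by omega⟩, mem_univ _⟩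
  have hs : f y₀ ≤ k := by
    refine le_trans ?_ (hf.trans' (card_image_le (f := f)))
    calc f y₀ = #(Finset.Icc 1 (f y₀)) := by simp
      _ ≤ _ := card_le_card fun m hm => by
        rw [Finset.mem_Icc] at hm
        obtain ⟨y, rfl⟩ := hseg y₀ m hm.2
        exact mem_image_of_mem f (by simp; omega)
  let Q : OrdPartition n k :=
    { s := f y₀
      block := fun i => {y : Fin n | f y = i.val}
      s_le := hs
      disjoint := fun i j hij => disjoint_left.2 fun y hi hj => by
        simp only [mem_filter, mem_univ, true_and] at hi hj
        exact hij (Fin.ext (hi.symm.trans hj))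
      nonempty := fun i => by
        obtain ⟨y, hy⟩ := hseg y₀ i.val (by omega)
        exact ⟨y, by simpa using hy⟩
      cover := fun y => ⟨⟨f y, Nat.lt_succ_of_le (hmax y (mem_univ y))⟩, by simp⟩
      card_le := (card_le_card fun y hy => by
        obtain ⟨i, hi, hy⟩ := mem_biUnion.1 hy
        have hi := mem_Ioi.1 hi
        rw [Fin.lt_def] at hi
        simp only [mem_filter, mem_univ, true_and] at hy ⊢
        simp at hi
        omega).trans hf }
  refine ⟨Q, funext fun y => ?_⟩
  have h := Q.mem_block_index y
  have h : f y = (Q.index y).val := by simpa [Q] using h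
  simp [toVec, h]

theorem toVec_mem_R3 (Q : OrdPartition n k) : Q.toVec ∈ R3 n k := by
  refine ⟨⟨?_, Q.toVec_nonneg, ?_⟩, fun y => ⟨(Q.index y).val, ?_, rfl⟩⟩
  · intro i j _ hij
    refine ⟨sortDesc_antitone _ (Fin.le_def.2 (by omega)), ?_⟩
    by_contra! hgap
    set σ := Tuple.sort (fun j => -Q.toVec j)
    have hgap' : Q.toVec (σ j) + 1 < Q.toVec (σ i) := hgap
    have hnat : (Q.index (σ j)).val + 1 < (Q.index (σ i)).val := by
      unfold toVec at hgap'
      exact_mod_cast hgap'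
    obtain ⟨y, hy⟩ := Q.exists_index_eq
      ⟨(Q.index (σ j)).val + 1, hnat.trans (Q.index (σ i)).isLt⟩
    have hyv : Q.toVec y = Q.toVec (σ j) + 1 := by simp [toVec, hy]
    obtain ⟨l, hl⟩ := exists_sortDesc_eq Q.toVec y
    rcases le_or_gt l i with h | h
    · have h1 : Q.toVec (σ i) ≤ sortDesc Q.toVec l := sortDesc_antitone Q.toVec h
      linarith
    · rw [Fin.lt_def] at h
      have h1 : sortDesc Q.toVec l ≤ Q.toVec (σ j) :=
        sortDesc_antitone Q.toVec (show j ≤ l from Fin.le_def.2 (by omega))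
      linarith
  · simpa only [ne_eq, toVec_eq_zero_iff] using Q.card_index_ne_zero
  · exact (Nat.lt_succ_iff.1 (Q.index y).isLt).trans Q.s_le

theorem exists_toVec_eq_of_mem_R3 (hkn : k < n) {u : Fin n → ℝ} (hu : u ∈ R3 n k) :
    ∃ Q : OrdPartition n k, Q.toVec = u := by
  obtain ⟨⟨hgap, hnn, hcard⟩, hint⟩ := hu
  choose f hfk hf using hint
  obtain rfl : u = fun y => (f y : ℝ) := funext hf
  have hcard' : #{y : Fin n | f y ≠ 0} ≤ k := by simpa using hcard
  refine exists_toVec_eq hkn f hcard' ?_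
  set σ := Tuple.sort (fun j => -(f j : ℝ))
  have hanti : ∀ i j, i ≤ j → f (σ j) ≤ f (σ i) := fun i j hij => by
    have : (f (σ j) : ℝ) ≤ (f (σ i) : ℝ) := sortDesc_antitone (fun y => (f y : ℝ)) hij
    exact_mod_cast this
  have hzero : f (σ ⟨k, hkn⟩) = 0 := by
    by_contra hne
    have hsub : (Finset.Iic (⟨k, hkn⟩ : Fin n)).map σ.toEmbedding ⊆
        ({y : Fin n | f y ≠ 0} : Finset (Fin n)) := by
      intro y hy
      obtain ⟨i, hi, rfl⟩ := mem_map.1 hy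
      have := hanti i _ (Finset.mem_Iic.1 hi)
      simp only [mem_filter, mem_univ, true_and, Equiv.coe_toEmbedding]
      omega
    have := card_le_card hsub
    rw [card_map, Fin.card_Iic] at this
    exact absurd (this.trans hcard') (Nat.not_succ_le_self k)
  intro y m hm
  rcases Nat.eq_zero_or_pos m with rfl | hm0
  · exact ⟨_, hzero⟩
  have hne : ({i : Fin n | m ≤ f (σ i)} : Finset (Fin n)).Nonempty :=
    ⟨σ.symm y, by simpa using hm⟩
  obtain ⟨i, hi, hlast⟩ := exists_max_image _ (fun i : Fin n => i) hne
  simp only [mem_filter, mem_univ, true_and] at hi hlast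
  have hik : i.val < k := by
    by_contra hik
    have := hanti ⟨k, hkn⟩ i (Fin.le_def.2 (by simpa using hik))
    omega
  have hnext := (hgap i ⟨i.val + 1, by omega⟩ hik rfl).2
  have hnext : (f (σ i) : ℝ) ≤ (f (σ ⟨i.val + 1, by omega⟩) : ℝ) + 1 := hnext
  have hnext : f (σ i) ≤ f (σ ⟨i.val + 1, by omega⟩) + 1 := by exact_mod_cast hnext
  refine ⟨σ i, ?_⟩
  by_contra hne
  have := Fin.le_def.1 (hlast ⟨i.val + 1, by omega⟩ (by omega))
  simp at this

theorem sum_Ioi_card_block (Q : OrdPartition n k) (j : Fin (Q.s + 1)) (g : Fin (Q.s + 1) → ℝ) :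
    ∑ i ∈ Ioi j, (#(Q.block i) : ℝ) * g i = ∑ y with j < Q.index y, g (Q.index y) := by
  rw [← sum_fiberwise_of_maps_to (t := Ioi j) (g := Q.index) (by simp)]
  refine sum_congr rfl fun i hi => ?_
  have hi := mem_Ioi.1 hi
  rw [Q.block_eq_filter, filter_filter, ← nsmul_eq_mul, ← sum_const]
  refine sum_congr (filter_congr fun y _ => ?_) fun y hy => ?_
  · constructor
    · rintro rfl
      exact ⟨hi, rfl⟩
    · exact fun h => h.2
  · simp only [mem_filter] at hy
    rw [hy.2.2]

end OrdPartition

open OrdPartition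

/-- On the vector of an ordered partition the surrogate is the discrete loss. -/
theorem L3_toVec (hkn : k < n) (Q : OrdPartition n k) (y : Fin n) :
    L3 n k Q.toVec y = hatL3 n k Q y := by
  obtain ⟨T, hyT, hT, htop⟩ := exists_competitors hkn Q.toVec y
  have hrest : ∀ l, l ≠ y → l ∉ T → Q.toVec l = 0 := by
    intro l hly hlT
    by_contra hne
    have hpos : 0 < Q.toVec l := lt_of_le_of_ne (Q.toVec_nonneg l) (Ne.symm hne)
    have hsub : insert l T ⊆ ({y : Fin n | Q.index y ≠ 0} : Finset (Fin n)) := by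
      intro j hj
      simp only [mem_filter, mem_univ, true_and, ne_eq, ← toVec_eq_zero_iff]
      rcases mem_insert.1 hj with rfl | hj
      · exact hne
      · exact (hpos.trans_le (htop j hj l hly hlT)).ne'
    have := (card_le_card hsub).trans Q.card_index_ne_zero
    rw [card_insert_of_notMem hlT] at this
    omega
  rw [L3_eq_sum hkn _ y T hyT hT htop]
  unfold hatL3
  split_ifs with h0
  · have hy0 := (Q.toVec_eq_zero_iff y).2 h0
    have hones := Q.sum_Ioi_card_block 0 fun _ => 1
    simp only [mul_one] at hones
    rw [hones, Q.sum_Ioi_card_block 0 fun i => (i.val : ℝ) + 1, sum_add_distrib]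
    congr 1
    have h1 : ∀ j ∈ T, max 0 (1 + Q.toVec j - Q.toVec y) = 1 + Q.toVec j := fun j _ => by
      rw [hy0, sub_zero, max_eq_right (by linarith [Q.toVec_nonneg j])]
    rw [sum_congr rfl h1, sum_add_distrib]
    have h2 : ∑ j ∈ T, Q.toVec j = ∑ j with 0 < Q.index j, Q.toVec j := by
      rw [sum_subset (subset_univ T), sum_filter_of_ne]
      · intro j _ hj
        exact Fin.pos_of_ne_zero fun h => hj ((Q.toVec_eq_zero_iff j).2 h)
      · intro l _ hl
        rcases eq_or_ne l y with rfl | hly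
        · exact hy0
        · exact hrest l hly hl
    rw [h2]
    simp only [sum_const, hT, nsmul_eq_mul, mul_one, toVec]
    ring
  · have hy1 : 1 ≤ Q.toVec y := by
      have : 0 < (Q.index y).val := Fin.pos_iff_ne_zero.2 h0
      unfold toVec
      exact_mod_cast this
    rw [Q.sum_Ioi_card_block (Q.index y) fun i => (i.val : ℝ) - ((Q.index y).val : ℝ) + 1]
    congr 1
    have h1 : ∑ j ∈ T, max 0 (1 + Q.toVec j - Q.toVec y)
        = ∑ j ∈ univ.erase y, max 0 (1 + Q.toVec j - Q.toVec y) := by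
      refine sum_subset (fun j hj => mem_erase.2 ⟨fun h => hyT (h ▸ hj), mem_univ j⟩) ?_
      intro l hl hlT
      rw [hrest l (ne_of_mem_erase hl) hlT]
      exact max_eq_left (by linarith)
    have h2 : ∀ j, max 0 (1 + Q.toVec j - Q.toVec y) = (if Q.index j = Q.index y then 1 else 0) +
        if Q.index y < Q.index j then Q.toVec j - Q.toVec y + 1 else 0 := by
      intro j
      rcases lt_trichotomy (Q.index j) (Q.index y) with h | h | h
      · have : Q.toVec j + 1 ≤ Q.toVec y := by
          unfold toVec
          exact_mod_cast Fin.lt_def.1 h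
        rw [if_neg h.ne, if_neg h.not_gt, max_eq_left (by linarith), add_zero]
      · simp [toVec, h]
      · have : Q.toVec y + 1 ≤ Q.toVec j := by
          unfold toVec
          exact_mod_cast Fin.lt_def.1 h
        rw [if_neg h.ne', if_pos h, max_eq_right (by linarith)]
        ring
    have h3 := add_sum_erase univ (fun j => max 0 (1 + Q.toVec j - Q.toVec y)) (mem_univ y)
    simp only [add_sub_cancel_right, max_eq_right (zero_le_one' ℝ)] at h3
    rw [h1, eq_sub_of_add_eq' h3]
    rw [sum_congr rfl fun j _ => h2 j, sum_add_distrib, ← sum_filter, ← sum_filter, sum_const,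
      nsmul_eq_mul, mul_one, Q.block_eq_filter]
    simp only [toVec]
    ring

/-! ### Compressing integer vectors -/

/-- The rank of `z y` among the distinct values of `z` that are at least `c`. -/
def level (z : Fin n → ℤ) (c : ℤ) (y : Fin n) : ℕ :=
  #{w ∈ univ.image z | c ≤ w ∧ w < z y}

theorem level_mono (z : Fin n → ℤ) (c : ℤ) {i j : Fin n} (h : z i ≤ z j) :
    level z c i ≤ level z c j :=
  card_le_card fun w hw => by
    simp only [mem_filter] at hw ⊢
    exact ⟨hw.1, hw.2.1, hw.2.2.trans_le h⟩

theorem level_lt (z : Fin n → ℤ) {c : ℤ} {i j : Fin n} (hc : c ≤ z i) (h : z i < z j) :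
    level z c i < level z c j := by
  refine card_lt_card (ssubset_iff_of_subset ?_ |>.2 ⟨z i, by simp [hc, h], by simp⟩)
  intro w hw
  simp only [mem_filter] at hw ⊢
  exact ⟨hw.1, hw.2.1, hw.2.2.trans h⟩

theorem level_sub_le (z : Fin n → ℤ) (c : ℤ) {i j : Fin n} (h : z i ≤ z j) :
    (level z c j : ℤ) ≤ level z c i + (z j - z i) := by
  have hsub : ({w ∈ univ.image z | c ≤ w ∧ w < z j} : Finset ℤ) ⊆
      {w ∈ univ.image z | c ≤ w ∧ w < z i} ∪ Finset.Ico (z i) (z j) := by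
    intro w hw
    simp only [mem_filter, mem_union, Finset.mem_Ico] at hw ⊢
    rcases lt_or_ge w (z i) with hlt | hge
    · exact Or.inl ⟨hw.1, hw.2.1, hlt⟩
    · exact Or.inr ⟨hge, hw.2.2⟩
  have h1 := (card_le_card hsub).trans (card_union_le _ _)
  rw [Int.card_Ico] at h1
  unfold level
  omega

theorem exists_level_eq (z : Fin n → ℤ) (c : ℤ) (y : Fin n) (m : ℕ) (hm : m ≤ level z c y) :
    ∃ y', level z c y' = m := by
  have step : ∀ m y, level z c y = m + 1 → ∃ y', level z c y' = m := by
    intro m y hy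
    have hne : ({w ∈ univ.image z | c ≤ w ∧ w < z y} : Finset ℤ).Nonempty := by
      rw [← card_pos]
      exact (Nat.succ_pos m).trans_eq hy.symm
    obtain ⟨w, hw, hmax⟩ := exists_max_image _ (fun w : ℤ => w) hne
    have hw' := hw
    simp only [mem_filter, mem_image, mem_univ, true_and] at hw'
    obtain ⟨⟨y', rfl⟩, hc, hlt⟩ := hw'
    refine ⟨y', ?_⟩
    have : ({w ∈ univ.image z | c ≤ w ∧ w < z y'} : Finset ℤ) =
        ({w ∈ univ.image z | c ≤ w ∧ w < z y} : Finset ℤ).erase (z y') := by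
      ext w
      simp only [mem_erase, mem_filter]
      constructor
      · exact fun h => ⟨h.2.2.ne, h.1, h.2.1, h.2.2.trans hlt⟩
      · exact fun h => ⟨h.2.1, h.2.2.1,
          lt_of_le_of_ne (hmax w (mem_filter.2 h.2)) h.1⟩
    unfold level at hy ⊢
    rw [this, card_erase_of_mem hw, hy, Nat.add_sub_cancel]
  induction hd : level z c y - m generalizing y with
  | zero => exact ⟨y, by omega⟩
  | succ d ih =>
    obtain ⟨y', hy'⟩ := step (level z c y - 1) y (by omega)
    exact ih y' (by omega) (by omega)

/-- Every integer vector is dominated, label by label, by an ordered partition. -/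
theorem exists_toVec_L3_le (hkn : k < n) (z : Fin n → ℤ) :
    ∃ Q : OrdPartition n k, ∀ y, L3 n k Q.toVec y ≤ L3 n k (fun y => (z y : ℝ)) y := by
  obtain ⟨T₀, -, hT₀, htop₀⟩ := exists_top_subset z univ (k + 1) (by simp; omega)
  obtain ⟨a, haT₀, hmin⟩ := exists_min_image T₀ z (card_pos.1 (by omega))
  have hfew : #{y : Fin n | level z (z a) y ≠ 0} ≤ k := by
    have hsub : ({y : Fin n | level z (z a) y ≠ 0} : Finset (Fin n)) ⊆ T₀.erase a := by
      intro y hy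
      simp only [mem_filter, mem_univ, true_and] at hy
      obtain ⟨w, hw⟩ := card_pos.1 (Nat.pos_of_ne_zero hy)
      simp only [mem_filter] at hw
      have hlt : z a < z y := hw.2.1.trans_lt hw.2.2
      refine mem_erase.2 ⟨fun h => by simp [h] at hlt, ?_⟩
      by_contra hyT
      exact absurd (htop₀ a haT₀ y (mem_univ y) hyT) (not_le.2 hlt)
    have := card_le_card hsub
    rw [card_erase_of_mem haT₀, hT₀] at this
    omega
  obtain ⟨Q, hQ⟩ := exists_toVec_eq hkn (level z (z a)) hfew (exists_level_eq z (z a))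
  refine ⟨Q, fun y => ?_⟩
  obtain ⟨T, hyT, hT, htop⟩ := exists_competitors hkn z y
  have hge : ∀ j ∈ T, z a ≤ z j := by
    intro j hj
    by_contra! hlt
    have hjT₀ : j ∉ T₀ := fun h => absurd (hmin j h) (not_le.2 hlt)
    have hsub : insert j (T₀.erase y) ⊆ T := by
      intro l hl
      rcases mem_insert.1 hl with rfl | hl
      · exact hj
      · by_contra hlT
        have h1 := htop j hj l (ne_of_mem_erase hl) hlT
        have h2 := hmin l (mem_of_mem_erase hl)
        omega
    have h1 := card_le_card hsub
    rw [card_insert_of_notMem fun h => hjT₀ (mem_of_mem_erase h)] at h1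
    have h2 := pred_card_le_card_erase (s := T₀) (a := y)
    omega
  rw [hQ, L3_eq_sum hkn _ y T hyT hT fun j hj l hl hlT =>
      Nat.cast_le.2 (level_mono z (z a) (htop j hj l hl hlT)),
    L3_eq_sum hkn _ y T hyT hT fun j hj l hl hlT => Int.cast_le.2 (htop j hj l hl hlT)]
  refine mul_le_mul_of_nonneg_left (sum_le_sum fun j hj => ?_) (by positivity)
  rcases lt_or_ge (z j) (z y) with h | h
  · have h1 : (level z (z a) j : ℝ) + 1 ≤ level z (z a) y := by
      exact_mod_cast level_lt z (hge j hj) h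
    exact max_le (le_max_left _ _) ((le_max_left _ _).trans' (by linarith))
  · have h1 : (level z (z a) j : ℝ) ≤ level z (z a) y + (z j - z y) := by
      exact_mod_cast level_sub_le z (z a) h
    exact max_le_max le_rfl (by linarith)

theorem exists_toVec_expLoss_le (hkn : k < n) {p : Fin n → ℝ} (hp : p ∈ stdSimplex ℝ (Fin n))
    (u : Fin n → ℝ) :
    ∃ Q : OrdPartition n k, expLoss (L3 n k) p Q.toVec ≤ expLoss (L3 n k) p u := by
  obtain ⟨z, hz⟩ := exists_int_expLoss_le hkn p u
  obtain ⟨Q, hQ⟩ := exists_toVec_L3_le hkn z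
  exact ⟨Q, (sum_le_sum fun y _ => mul_le_mul_of_nonneg_left (hQ y) (hp.1 y)).trans hz⟩

/-! ### Representativeness and embedding -/

theorem R3_finite : (R3 n k).Finite := by
  refine (Set.Finite.pi' fun _ : Fin n =>
    (Set.finite_Iic k).image (fun m : ℕ => (m : ℝ))).subset fun u hu y => ?_
  obtain ⟨m, hm, hum⟩ := hu.2 y
  exact ⟨m, hm, hum.symm⟩

theorem finite_ordPartition : Finite (OrdPartition n k) :=
  have := (R3_finite (n := n) (k := k)).to_subtype
  Finite.of_injective (fun Q : OrdPartition n k => (⟨Q.toVec, Q.toVec_mem_R3⟩ : R3 n k))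
    fun _ _ h => toVec_injective (congrArg Subtype.val h)

theorem expLoss_toVec (hkn : k < n) (p : Fin n → ℝ) (Q : OrdPartition n k) :
    expLoss (L3 n k) p Q.toVec = expLoss (hatL3 n k) p Q :=
  sum_congr rfl fun y _ => by rw [L3_toVec hkn]

theorem mem_prop_hatL3_iff (hkn : k < n) {p : Fin n → ℝ} (hp : p ∈ stdSimplex ℝ (Fin n))
    (Q : OrdPartition n k) : Q ∈ prop (hatL3 n k) p ↔ Q.toVec ∈ prop (L3 n k) p := by
  constructor
  · intro h u
    obtain ⟨Q', hQ'⟩ := exists_toVec_expLoss_le hkn hp u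
    refine le_trans ?_ hQ'
    rw [expLoss_toVec hkn, expLoss_toVec hkn]
    exact h Q'
  · intro h Q'
    rw [← expLoss_toVec hkn, ← expLoss_toVec hkn]
    exact h Q'.toVec

theorem exists_mem_prop_hatL3 (hkn : k < n) {p : Fin n → ℝ} (hp : p ∈ stdSimplex ℝ (Fin n)) :
    ∃ Q, Q ∈ prop (hatL3 n k) p := by
  have := finite_ordPartition (n := n) (k := k)
  have : Nonempty (OrdPartition n k) := ⟨(exists_toVec_expLoss_le hkn hp 0).choose⟩
  exact Finite.exists_min (expLoss (hatL3 n k) p)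

theorem embeds_hatL3 (hkn : k < n) : Embeds (L3 n k) (hatL3 n k) := by
  refine ⟨Set.univ, fun p hp => ?_, fun Q => Q.1.toVec,
    toVec_injective.comp Subtype.val_injective, fun Q y => L3_toVec hkn Q.1 y,
    fun p hp Q => mem_prop_hatL3_iff hkn hp Q.1⟩
  rw [Set.inter_univ]
  exact exists_mem_prop_hatL3 hkn hp

end TopK

theorem mainTheorem8 (n k : ℕ) (hk : 1 ≤ k) (hkn : k < n) :
    -- the integer points of the bounded region form a finite representative set
    (TopK.R3 n k).Finite ∧ TopK.IsRepresentative (TopK.L3 n k) (TopK.R3 n k) ∧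
    -- ordered partitions relabel these points bijectively, and the discrete loss is `L₃` there
    Set.BijOn (fun Q : TopK.OrdPartition n k => Q.toVec) Set.univ (TopK.R3 n k) ∧
    (∀ (Q : TopK.OrdPartition n k) (y : Fin n),
      TopK.L3 n k Q.toVec y = TopK.hatL3 n k Q y) ∧
    -- both losses are nonnegative, the report set is finite, and `L₃` embeds the discrete loss
    (∀ (u : Fin n → ℝ) (y : Fin n), 0 ≤ TopK.L3 n k u y) ∧
    (∀ (Q : TopK.OrdPartition n k) (y : Fin n), 0 ≤ TopK.hatL3 n k Q y) ∧
    Finite (TopK.OrdPartition n k) ∧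
    TopK.Embeds (TopK.L3 n k) (TopK.hatL3 n k) := by
  refine ⟨TopK.R3_finite, fun p hp => ?_, ⟨fun Q _ => Q.toVec_mem_R3,
    TopK.OrdPartition.toVec_injective.injOn, fun u hu => ?_⟩, TopK.L3_toVec hkn, TopK.L3_nonneg,
    fun Q y => TopK.L3_toVec hkn Q y ▸ TopK.L3_nonneg _ y, TopK.finite_ordPartition,
    TopK.embeds_hatL3 hkn⟩
  · obtain ⟨Q, hQ⟩ := TopK.exists_mem_prop_hatL3 hkn hp
    exact ⟨Q.toVec, (TopK.mem_prop_hatL3_iff hkn hp Q).1 hQ, Q.toVec_mem_R3⟩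
  · obtain ⟨Q, hQ⟩ := TopK.OrdPartition.exists_toVec_eq_of_mem_R3 hkn hu
    exact ⟨Q, Set.mem_univ Q, hQ⟩
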